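/- Let $n\ge 1$, let $h=(h_1,\dots,h_n)$ have positive entries with $\sum_{i=1}^n h_i=1$, let $1\ge\alpha_1\ge\alpha_2\ge\cdots\ge\alpha_n\ge 0$, and let $\sigma>0$. Consider the MISO optical intensity channel $Y=\sum_{i=1}^n h_iX_i+Z$, where $Z\sim\mathcal N(0,\sigma^2)$ is independent of the input $\mathbf X=(X_1,\dots,X_n)$. Its bounded-cost capacity is $$\mathsf C_{\mathrm B}(h,\alpha,\sigma)=\sup_{P_{\mathbf X}} I(\mathbf X;Y),$$ the supremum being over all probability laws of $\mathbf X$ on $\mathbb R^n$ with $0\le X_k\le 1$ almost surely and $\mathbb E[X_k]\le\alpha_k$ for every $k\in\{1,\dots,n\}$. For $k\in\{0,1,\dots,n-1\}$ put $$\mathsf H_{[k]}=\sum_{i=1}^k h_i,\qquad \bar\alpha_k=\frac{\sum_{i=k+1}^n h_i\alpha_i}{1-\mathsf H_{[k]}}.$$ Then $$\mathsf C_{\mathrm B}(h,\alpha,\sigma)=\max_{P_S} I(S;S+Z),$$ where $Z\sim\mathcal N(0,\sigma^2)$ is independent of $S$, and the maximum, which is attained, is over all probability laws of a real random variable $S$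 supported in $[0,1]$ such that $$\mathbb E\big[(S-\mathsf H_{[k]})_+\big]\le (1-\mathsf H_{[k]})\,\bar\alpha_k\qquad\text{for all }k\in\{0,1,\dots,n-1\},$$ with $(a)_+=\max\{a,0\}$. -/

import Mathlib

open MeasureTheory ProbabilityTheory
open scoped NNReal ENNReal

noncomputable section

/-- The mutual information `I(X; Y)` in nats of two random elements on the probability space
`(Ω, μ)`: the Kullback-Leibler divergence of the joint law from the product of the marginals. -/
def mutualInfo {Ω E F : Type*} [MeasurableSpace Ω] [MeasurableSpace E] [MeasurableSpace F]
    (μ : Measure Ω) (X : Ω → E) (Y : Ω → F) : ℝ≥0∞ :=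
  InformationTheory.klDiv (μ.map (fun ω => (X ω, Y ω))) ((μ.map X).prod (μ.map Y))

/-- `I(X; Y)` for the MISO channel `Y = hᵀX + Z`, where `X` has law `P` on `ℝⁿ` and
`Z ∼ N(0, σ²)` is independent of `X`. -/
def misoInfo {n : ℕ} (h : Fin n → ℝ) (σ : ℝ≥0) (P : Measure (Fin n → ℝ)) : ℝ≥0∞ :=
  mutualInfo (P.prod (gaussianReal 0 (σ ^ 2)))
    (fun ω => ω.1) (fun ω => (∑ i, h i * ω.1 i) + ω.2)

/-- `I(S; S + Z)`, where `S` has law `P` on `ℝ` and `Z ∼ N(0, σ²)` is independent of `S`. -/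
def sisoInfo (σ : ℝ≥0) (P : Measure ℝ) : ℝ≥0∞ :=
  mutualInfo (P.prod (gaussianReal 0 (σ ^ 2))) (fun ω => ω.1) (fun ω => ω.1 + ω.2)

/-- Input laws feasible under the bounded-cost constraints: almost surely `0 ≤ X_k ≤ 1`, and
`E[X_k] ≤ α_k`, for every antenna `k`. -/
def IsBoundedCostLaw {n : ℕ} (α : Fin n → ℝ) (P : Measure (Fin n → ℝ)) : Prop :=
  IsProbabilityMeasure P ∧
    ∀ k, (∀ᵐ x ∂P, 0 ≤ x k ∧ x k ≤ 1) ∧ ∫ x, x k ∂P ≤ α k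

/-- The capacity of the MISO bounded-cost constrained optical intensity channel. -/
def capacityB {n : ℕ} (h α : Fin n → ℝ) (σ : ℝ≥0) : ℝ≥0∞ :=
  sSup {I | ∃ P : Measure (Fin n → ℝ), IsBoundedCostLaw α P ∧ I = misoInfo h σ P}

/-- The cumulative gain `H_[k]`, the sum of the first `k` channel gains (so `H_[0] = 0`). -/
def cumGain {n : ℕ} (h : Fin n → ℝ) (k : ℕ) : ℝ :=
  ∑ i with i.val < k, h i

/-- The weighted average intensity `ᾱ_k` of the last `n - k` transmitters; antennas are indexed
from `0`, so these are the indices `i ≥ k`. It is used for `k < n` only, where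
`1 - H_[k] > 0`. -/
def tailMean {n : ℕ} (h α : Fin n → ℝ) (k : ℕ) : ℝ :=
  (∑ i with k ≤ i.val, h i * α i) / (1 - cumGain h k)

/-- Laws of the equivalent scalar input `S`: supported in `[0, 1]` and satisfying the `n`
stop-loss mean constraints. -/
def IsStopLossLaw {n : ℕ} (h α : Fin n → ℝ) (P : Measure ℝ) : Prop :=
  IsProbabilityMeasure P ∧ (∀ᵐ s ∂P, 0 ≤ s ∧ s ≤ 1) ∧
    ∀ k : ℕ, k < n →
      ∫ s, max (s - cumGain h k) 0 ∂P ≤ (1 - cumGain h k) * tailMean h α k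

end

/-! The output depends on the input only through `S = ∑ h i * X i`, and the mutual information is
the differential entropy of the output minus that of the noise, a function of the law of `S` alone.
It remains to identify the possible laws of `S`.

On the unit cube the first `k` antennas contribute at most `H_[k]`, so `(S - H_[k])₊` is at most the
contribution of the others; this gives the stop-loss constraints. Conversely, filling the antennas
in order makes that bound an equality (`sum_tail_greedyAlloc`), so the constraints say that the tail
sums of the mean allocation are dominated by those of `α`. Single means may still exceed `α k`.
Since `α` is antitone, finitely many pairwise transfers repair this (`exists_isMixing_le`). Their
composite is linear, so applying it pointwise moves the mean in the same way, while the cube and `S`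
are respected.

The maximum is attained because the laws on `[0, 1]` form a weakly compact space on which the
constraints are closed and the output entropy is continuous. -/

/-! ### Mixing maps and tail-sum domination -/

/-- A linear map of allocations that keeps the unit cube invariant and preserves the
`h`-weighted sum. -/
def IsMixing {n : ℕ} (h : Fin n → ℝ) (L : (Fin n → ℝ) →ₗ[ℝ] (Fin n → ℝ)) : Prop :=
  (∀ v, (∀ k, 0 ≤ v k ∧ v k ≤ 1) → ∀ k, 0 ≤ L v k ∧ L v k ≤ 1) ∧
    ∀ v, ∑ k, h k * L v k = ∑ k, h k * v k

theorem IsMixing.id {n : ℕ} (h : Fin n → ℝ) : IsMixing h LinearMap.id :=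
  ⟨fun _ hv => hv, fun _ => rfl⟩

theorem IsMixing.comp {n : ℕ} {h : Fin n → ℝ} {L M : (Fin n → ℝ) →ₗ[ℝ] (Fin n → ℝ)}
    (hL : IsMixing h L) (hM : IsMixing h M) : IsMixing h (L ∘ₗ M) :=
  ⟨fun v hv => hL.1 _ (hM.1 v hv), fun v => (hL.2 _).trans (hM.2 v)⟩

/-- The transfer map moving `h i * a * (v i - v j) = h j * b * (v i - v j)` from `i` to `j`. -/
noncomputable def transferMap {n : ℕ} (i j : Fin n) (a b : ℝ) : (Fin n → ℝ) →ₗ[ℝ] (Fin n → ℝ) :=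
  LinearMap.id +
    ((LinearMap.proj i : (Fin n → ℝ) →ₗ[ℝ] ℝ) - LinearMap.proj j).smulRight
      (Pi.single j b - Pi.single i a)

theorem transferMap_apply {n : ℕ} (i j : Fin n) (a b : ℝ) (v : Fin n → ℝ) (k : Fin n) :
    transferMap i j a b v k =
      v k + (v i - v j) * ((if k = j then b else 0) - (if k = i then a else 0)) := by
  simp [transferMap, Pi.single_apply]

/-- What leaves `i` arrives at `j`. A general `s` serves both the total sum and the tail sums. -/
theorem sum_transferMap {n : ℕ} {h : Fin n → ℝ} {i j : Fin n} {a b : ℝ} (hab : h i * a = h j * b)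
    {s : Finset (Fin n)} (hi : i ∈ s) (hj : j ∈ s) (v : Fin n → ℝ) :
    ∑ k ∈ s, h k * transferMap i j a b v k = ∑ k ∈ s, h k * v k := by
  have e : ∀ k, h k * transferMap i j a b v k = h k * v k +
      ((if k = j then h k * (v i - v j) * b else 0) -
        (if k = i then h k * (v i - v j) * a else 0)) := by
    intro k
    rw [transferMap_apply]
    split_ifs <;> ring
  simp only [e, Finset.sum_add_distrib, Finset.sum_sub_distrib, Finset.sum_ite_eq', hi, hj,
    if_true]
  linear_combination (v i - v j) * (-hab)

/-- The new coordinates `i` and `j` are convex combinations of `v i` and `v j`. -/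
theorem isMixing_transferMap {n : ℕ} {h : Fin n → ℝ} {i j : Fin n} (hij : i ≠ j) {a b : ℝ}
    (ha : 0 ≤ a ∧ a ≤ 1) (hb : 0 ≤ b ∧ b ≤ 1) (hab : h i * a = h j * b) :
    IsMixing h (transferMap i j a b) := by
  refine ⟨fun v hv k => ?_, fun v =>
    sum_transferMap hab (Finset.mem_univ _) (Finset.mem_univ _) v⟩
  rw [transferMap_apply]
  have h1 := hv i
  have h2 := hv j
  have h3 := hv k
  by_cases hki : k = i
  · subst hki
    simp only [hij, if_false, if_true]
    constructor <;> nlinarith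
  · by_cases hkj : k = j
    · subst hkj
      simp only [hki, if_false, if_true]
      constructor <;> nlinarith
    · simp [hki, hkj, h3.1, h3.2]

/-- If all tail sums of `x` are dominated by those of an antitone `α`, some mixing map brings `x`
below `α`. -/
theorem exists_isMixing_le {n : ℕ} {h α : Fin n → ℝ} (hh : ∀ k, 0 < h k) (hα : Antitone α)
    (x : Fin n → ℝ)
    (hx : ∀ k : Fin n, ∑ i with k ≤ i, h i * x i ≤ ∑ i with k ≤ i, h i * α i) :
    ∃ L, IsMixing h L ∧ ∀ k, L x k ≤ α k := by
  induction hc : (Finset.univ.filter fun k => x k ≠ α k).card using Nat.strong_induction_on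
    generalizing x with
  | _ c ih =>
  by_cases hle : ∀ k, x k ≤ α k
  · exact ⟨_, IsMixing.id h, hle⟩
  push Not at hle
  -- Take the last antenna above its budget.
  obtain ⟨i, hi, hmax⟩ : ∃ i, α i < x i ∧ ∀ m, i < m → x m ≤ α m := by
    obtain ⟨i0, hi0⟩ := hle
    obtain ⟨i, hi, hm⟩ := Finset.exists_max_image (Finset.univ.filter fun k => α k < x k) _root_.id
      ⟨i0, by simpa using hi0⟩
    refine ⟨i, by simpa using hi, fun m hmi => ?_⟩
    by_contra hcon
    exact absurd (hm m (by simpa using hcon)) (not_le.2 hmi)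
  -- Without a later deficit, the tail sum from `i` would exceed that of `α`.
  obtain ⟨j, hij, hj⟩ : ∃ j, i < j ∧ x j < α j := by
    by_contra hcon
    push Not at hcon
    refine absurd (hx i) (not_le.2 (Finset.sum_lt_sum ?_ ⟨i, by simp, ?_⟩))
    · intro m hm
      simp only [Finset.mem_filter, Finset.mem_univ, true_and] at hm
      rcases hm.eq_or_lt with rfl | hm
      · exact mul_le_mul_of_nonneg_left hi.le (hh _).le
      · exact mul_le_mul_of_nonneg_left (hcon m hm) (hh _).le
    · exact mul_lt_mul_of_pos_left hi (hh _)
  have hαij := hα hij.le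
  have hD : 0 < x i - x j := by linarith
  have hhi := hh i
  have hhj := hh j
  -- The smaller of the weighted excess and deficit: one of the two coordinates becomes exact and
  -- neither overshoots. As `x j < α j ≤ α i < x i`, both `a` and `b` are at most `1`.
  set δ := min (h i * (x i - α i)) (h j * (α j - x j)) with hδ
  have hδ0 : 0 < δ := lt_min (mul_pos hhi (by linarith)) (mul_pos hhj (by linarith))
  have hδi : δ ≤ h i * (x i - α i) := min_le_left _ _
  have hδj : δ ≤ h j * (α j - x j) := min_le_right _ _
  set a := δ / (h i * (x i - x j)) with ha
  set b := δ / (h j * (x i - x j)) with hb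
  have ha' : (x i - x j) * a = δ / h i := by rw [ha]; field_simp
  have hb' : (x i - x j) * b = δ / h j := by rw [hb]; field_simp
  have hab : h i * a = h j * b := by rw [ha, hb]; field_simp
  have ha01 : 0 ≤ a ∧ a ≤ 1 := ⟨by positivity, by
    rw [ha, div_le_one (by positivity)]
    exact hδi.trans (mul_le_mul_of_nonneg_left (by linarith) hhi.le)⟩
  have hb01 : 0 ≤ b ∧ b ≤ 1 := ⟨by positivity, by
    rw [hb, div_le_one (by positivity)]
    exact hδj.trans (mul_le_mul_of_nonneg_left (by linarith) hhj.le)⟩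
  set y := transferMap i j a b x with hy
  have hyi : y i = x i - δ / h i := by
    rw [hy, transferMap_apply, if_neg hij.ne, if_pos rfl]; linear_combination -ha'
  have hyj : y j = x j + δ / h j := by
    rw [hy, transferMap_apply, if_neg hij.ne', if_pos rfl]; linear_combination hb'
  have hyk : ∀ k, k ≠ i → k ≠ j → y k = x k := by
    intro k hki hkj
    rw [hy, transferMap_apply, if_neg hki, if_neg hkj]; ring
  have hyjle : y j ≤ α j := by
    rw [hyj]
    have : δ / h j ≤ α j - x j := by rw [div_le_iff₀ hhj]; linarith
    linarith
  -- Tails from `k ≤ i` contain both `i` and `j`, hence are unchanged; later tails are dominated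
  -- termwise.
  have htail : ∀ k : Fin n, ∑ m with k ≤ m, h m * y m ≤ ∑ m with k ≤ m, h m * α m := by
    intro k
    rcases le_or_gt k i with hk | hk
    · rw [hy, sum_transferMap hab (by simpa using hk) (by simpa using hk.trans hij.le)]
      exact hx k
    · refine Finset.sum_le_sum fun m hm => mul_le_mul_of_nonneg_left ?_ (hh m).le
      simp only [Finset.mem_filter, Finset.mem_univ, true_and] at hm
      have him : i < m := hk.trans_le hm
      by_cases hmj : m = j
      · exact hmj ▸ hyjle
      · rw [hyk m him.ne' hmj]
        exact hmax m him
  have hcard : (Finset.univ.filter fun k => y k ≠ α k).card < c := by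
    rw [← hc]
    apply Finset.card_lt_card
    rw [Finset.ssubset_iff_subset_ne]
    have hsub : (Finset.univ.filter fun k => y k ≠ α k) ⊆
        Finset.univ.filter fun k => x k ≠ α k := by
      intro k hk
      simp only [Finset.mem_filter, Finset.mem_univ, true_and] at hk ⊢
      by_cases hki : k = i
      · exact hki ▸ hi.ne'
      by_cases hkj : k = j
      · exact hkj ▸ hj.ne
      rwa [hyk k hki hkj] at hk
    refine ⟨hsub, fun heq => ?_⟩
    have hmi : i ∈ Finset.univ.filter fun k => y k ≠ α k := by
      rw [heq]; simpa using hi.ne'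
    have hmj : j ∈ Finset.univ.filter fun k => y k ≠ α k := by
      rw [heq]; simpa using hj.ne
    simp only [Finset.mem_filter, Finset.mem_univ, true_and] at hmi hmj
    rcases min_choice (h i * (x i - α i)) (h j * (α j - x j)) with hm | hm
    · apply hmi
      rw [hyi, hδ, hm]; field_simp; ring
    · apply hmj
      rw [hyj, hδ, hm]; field_simp; ring
  obtain ⟨L, hL, hLle⟩ := ih _ hcard y htail rfl
  exact ⟨L ∘ₗ transferMap i j a b,
    hL.comp (isMixing_transferMap hij.ne ha01 hb01 hab), hLle⟩

/-! ### Cumulative gains and the greedy allocation -/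

theorem cumGain_zero {n : ℕ} (h : Fin n → ℝ) : cumGain h 0 = 0 := by simp [cumGain]

theorem cumGain_of_le {n : ℕ} (h : Fin n → ℝ) {k : ℕ} (hk : n ≤ k) : cumGain h k = ∑ i, h i := by
  unfold cumGain
  rw [Finset.filter_true_of_mem fun i _ => i.2.trans_le hk]

theorem cumGain_succ {n : ℕ} (h : Fin n → ℝ) (k : Fin n) :
    cumGain h (k + 1) = cumGain h k + h k := by
  unfold cumGain
  have : (Finset.univ.filter fun i : Fin n => i.val < k.val + 1) =
      insert k (Finset.univ.filter fun i : Fin n => i.val < k.val) := by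
    ext i
    simp only [Finset.mem_filter, Finset.mem_univ, true_and, Finset.mem_insert, Fin.ext_iff]
    omega
  rw [this, Finset.sum_insert (by simp), add_comm]

theorem cumGain_add_tail {n : ℕ} (h : Fin n → ℝ) (k : ℕ) :
    cumGain h k + ∑ i with k ≤ i.val, h i = ∑ i, h i := by
  unfold cumGain
  rw [← Finset.sum_filter_add_sum_filter_not Finset.univ (fun i : Fin n => i.val < k)]
  simp

theorem cumGain_lt_one {n : ℕ} {h : Fin n → ℝ} (hh : ∀ k, 0 < h k) (hsum : ∑ k, h k = 1)
    {k : ℕ} (hk : k < n) : cumGain h k < 1 := by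
  have := cumGain_add_tail h k
  have : 0 < ∑ i with k ≤ i.val, h i :=
    Finset.sum_pos (fun i _ => hh i) ⟨⟨k, hk⟩, by simp⟩
  linarith

theorem one_sub_cumGain_mul_tailMean {n : ℕ} {h : Fin n → ℝ} (hh : ∀ k, 0 < h k)
    (hsum : ∑ k, h k = 1) (α : Fin n → ℝ) {k : ℕ} (hk : k < n) :
    (1 - cumGain h k) * tailMean h α k = ∑ i with k ≤ i.val, h i * α i :=
  mul_div_cancel₀ _ (sub_pos.2 (cumGain_lt_one hh hsum hk)).ne'

theorem sum_tail_sub_succ {n : ℕ} (g : ℕ → ℝ) {k : ℕ} (hk : k ≤ n) :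
    ∑ i : Fin n with k ≤ i.val, (g i - g (i + 1)) = g k - g n := by
  rw [Finset.sum_filter, Fin.sum_univ_eq_sum_range (fun i => if k ≤ i then g i - g (i + 1) else 0)]
  induction n, hk using Nat.le_induction with
  | base =>
    rw [sub_self]
    exact Finset.sum_eq_zero fun i hi => if_neg (not_le.2 (Finset.mem_range.1 hi))
  | succ m hm ih => rw [Finset.sum_range_succ, ih, if_pos hm]; ring

/-- The minimum-energy allocation of a total amplitude `s`: the antennas are filled one after the
other. -/
noncomputable def greedyAlloc {n : ℕ} (h : Fin n → ℝ) (s : ℝ) (k : Fin n) : ℝ :=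
  (max (s - cumGain h k) 0 - max (s - cumGain h (k + 1)) 0) / h k

theorem greedyAlloc_mem {n : ℕ} {h : Fin n → ℝ} (hh : ∀ k, 0 < h k) (s : ℝ) (k : Fin n) :
    0 ≤ greedyAlloc h s k ∧ greedyAlloc h s k ≤ 1 := by
  have := hh k
  unfold greedyAlloc
  rw [cumGain_succ, div_le_one this]
  refine ⟨div_nonneg (sub_nonneg.2 (max_le_max (by linarith) le_rfl)) this.le, ?_⟩
  have h1 : max (s - cumGain h k) 0 ≤ max (s - (cumGain h k + h k)) 0 + h k :=
    max_le (by linarith [le_max_left (s - (cumGain h k + h k)) 0])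
      (by linarith [le_max_right (s - (cumGain h k + h k)) 0])
  linarith

/-- The sum telescopes; its last term `max (s - 1) 0` vanishes because `s ≤ 1`. -/
theorem sum_tail_greedyAlloc {n : ℕ} {h : Fin n → ℝ} (hh : ∀ k, 0 < h k) (hsum : ∑ k, h k = 1)
    {s : ℝ} (hs : s ≤ 1) {k : ℕ} (hk : k ≤ n) :
    ∑ i with k ≤ i.val, h i * greedyAlloc h s i = max (s - cumGain h k) 0 := by
  have e : ∀ i : Fin n, h i * greedyAlloc h s i =
      max (s - cumGain h i) 0 - max (s - cumGain h (i + 1)) 0 :=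
    fun i => mul_div_cancel₀ _ (hh i).ne'
  simp only [e]
  rw [sum_tail_sub_succ (fun i => max (s - cumGain h i) 0) hk, cumGain_of_le h le_rfl, hsum,
    max_eq_right (by linarith : s - 1 ≤ 0), sub_zero]

theorem continuous_greedyAlloc {n : ℕ} (h : Fin n → ℝ) : Continuous (greedyAlloc h) := by
  unfold greedyAlloc
  fun_prop

/-! ### Correspondence between vector and scalar input laws -/

/-- The weighted sum of a feasible input is a feasible scalar input. -/
theorem IsBoundedCostLaw.isStopLossLaw_map {n : ℕ} {h α : Fin n → ℝ} (hh : ∀ k, 0 < h k)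
    (hsum : ∑ k, h k = 1) {P : Measure (Fin n → ℝ)} (hP : IsBoundedCostLaw α P) :
    IsStopLossLaw h α (P.map fun x => ∑ i, h i * x i) := by
  obtain ⟨hprob, hk⟩ := hP
  have hm : Measurable fun x : Fin n → ℝ => ∑ i, h i * x i := by fun_prop
  have hbox : ∀ᵐ x ∂P, ∀ k, 0 ≤ x k ∧ x k ≤ 1 := ae_all_iff.2 fun k => (hk k).1
  have hint : ∀ k, Integrable (fun x : Fin n → ℝ => x k) P := fun k =>
    Integrable.of_bound (measurable_pi_apply k).aestronglyMeasurable 1 <| hbox.mono fun x hx => by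
      rw [Real.norm_eq_abs, abs_of_nonneg (hx k).1]; exact (hx k).2
  refine ⟨Measure.isProbabilityMeasure_map hm.aemeasurable, ?_, fun k hkn => ?_⟩
  · refine (ae_map_iff hm.aemeasurable (measurableSet_Icc (a := (0 : ℝ)) (b := 1))).2 ?_
    filter_upwards [hbox] with x hx
    refine ⟨Finset.sum_nonneg fun i _ => mul_nonneg (hh i).le (hx i).1, ?_⟩
    calc ∑ i, h i * x i ≤ ∑ i, h i * 1 :=
          Finset.sum_le_sum fun i _ => mul_le_mul_of_nonneg_left (hx i).2 (hh i).le
      _ = 1 := by simp [hsum]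
  · rw [one_sub_cumGain_mul_tailMean hh hsum α hkn,
      integral_map hm.aemeasurable (by fun_prop)]
    calc ∫ x, max (∑ i, h i * x i - cumGain h k) 0 ∂P
        ≤ ∫ x, ∑ i with k ≤ i.val, h i * x i ∂P := by
          refine integral_mono_of_nonneg (ae_of_all _ fun x => le_max_right _ _)
            (integrable_finsetSum _ fun i _ => (hint i).const_mul _) ?_
          filter_upwards [hbox] with x hx
          refine max_le ?_ (Finset.sum_nonneg fun i _ => mul_nonneg (hh i).le (hx i).1)
          have h1 := Finset.sum_filter_add_sum_filter_not Finset.univ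
            (fun i : Fin n => i.val < k) (fun i => h i * x i)
          have h2 : ∑ i with i.val < k, h i * x i ≤ cumGain h k :=
            Finset.sum_le_sum fun i _ => mul_le_of_le_one_right (hh i).le (hx i).2
          simp only [not_lt] at h1
          linarith
      _ = ∑ i with k ≤ i.val, h i * ∫ x, x i ∂P := by
          rw [integral_finsetSum _ fun i _ => (hint i).const_mul _]
          simp only [integral_const_mul]
      _ ≤ _ := Finset.sum_le_sum fun i _ => mul_le_mul_of_nonneg_left (hk i).2 (hh i).le

/-- Every feasible scalar input is the weighted sum of a feasible input. -/
theorem IsStopLossLaw.exists_isBoundedCostLaw {n : ℕ} {h α : Fin n → ℝ} (hh : ∀ k, 0 < h k)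
    (hsum : ∑ k, h k = 1) (hα : Antitone α) {Q : Measure ℝ} (hQ : IsStopLossLaw h α Q) :
    ∃ P : Measure (Fin n → ℝ), IsBoundedCostLaw α P ∧ P.map (fun x => ∑ i, h i * x i) = Q := by
  obtain ⟨hprob, hsupp, hmean⟩ := hQ
  have hg : Integrable (greedyAlloc h) Q :=
    Integrable.of_bound (continuous_greedyAlloc h).aestronglyMeasurable 1 <| ae_of_all _ fun s =>
      (pi_norm_le_iff_of_nonneg zero_le_one).2 fun k => by
        rw [Real.norm_eq_abs, abs_of_nonneg (greedyAlloc_mem hh s k).1]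
        exact (greedyAlloc_mem hh s k).2
  have hgk : ∀ k, Integrable (fun s => greedyAlloc h s k) Q := fun k => hg.eval k
  have heval : ∀ (F : ℝ → Fin n → ℝ), Integrable F Q → ∀ k, (∫ s, F s ∂Q) k = ∫ s, F s k ∂Q :=
    fun F hF k => eval_integral (fun i => hF.eval i) k
  -- `L` is chosen for the mean of the greedy allocation, then applied to every realization.
  obtain ⟨L, hL, hLle⟩ := exists_isMixing_le hh hα (∫ s, greedyAlloc h s ∂Q) fun k => by
    calc ∑ i with k ≤ i, h i * (∫ s, greedyAlloc h s ∂Q) i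
        = ∫ s, ∑ i with k ≤ i, h i * greedyAlloc h s i ∂Q := by
          rw [integral_finsetSum _ fun i _ => (hgk i).const_mul _]
          simp only [integral_const_mul, heval _ hg]
      _ = ∫ s, max (s - cumGain h k) 0 ∂Q := integral_congr_ae <| hsupp.mono fun s hs =>
          sum_tail_greedyAlloc hh hsum hs.2 k.2.le
      _ ≤ _ := by
          have := hmean k k.2
          rwa [one_sub_cumGain_mul_tailMean hh hsum α k.2] at this
  have hLc : Continuous L := L.continuous_of_finiteDimensional
  have hc : Continuous fun s => L (greedyAlloc h s) := hLc.comp (continuous_greedyAlloc h)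
  have hLint : Integrable (fun s => L (greedyAlloc h s)) Q :=
    L.toContinuousLinearMap.integrable_comp hg
  refine ⟨Q.map fun s => L (greedyAlloc h s),
    ⟨Measure.isProbabilityMeasure_map hc.aemeasurable, fun k => ⟨?_, ?_⟩⟩, ?_⟩
  · refine (ae_map_iff hc.aemeasurable ((measurableSet_Icc (a := (0 : ℝ)) (b := 1)).preimage
      (measurable_pi_apply k))).2 ?_
    exact ae_of_all _ fun s => hL.1 _ (greedyAlloc_mem hh s) k
  · rw [integral_map hc.aemeasurable (measurable_pi_apply k).aestronglyMeasurable, ← heval _ hLint]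
    have : ∫ s, L (greedyAlloc h s) ∂Q = L (∫ s, greedyAlloc h s ∂Q) :=
      L.toContinuousLinearMap.integral_comp_comm hg
    rw [this]
    exact hLle k
  · rw [Measure.map_map (by fun_prop) hc.measurable]
    conv_rhs => rw [← Measure.map_id (μ := Q)]
    refine Measure.map_congr (hsupp.mono fun s hs => ?_)
    -- The tail from `0` is the whole sum, so the total amplitude is `s`.
    have h0 := sum_tail_greedyAlloc hh hsum hs.2 (Nat.zero_le n)
    simp only [Nat.zero_le, Finset.filter_true, cumGain_zero, sub_zero, max_eq_left hs.1] at h0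
    exact (hL.2 _).trans h0

/-! ### Gaussian envelopes for the output density -/

/-- The density at `y` of the output of the additive Gaussian channel with noise variance `v` and
input law `P`. -/
noncomputable def outputDensity (v : ℝ≥0) (P : Measure ℝ) (y : ℝ) : ℝ :=
  ∫ s, gaussianPDFReal 0 v (y - s) ∂P

/-- Uniform in `s`, from `(y - s)² ≤ 2y² + 2s² ≤ 2(y² + 1)`. -/
theorem gaussianPDFReal_sub_lower {v : ℝ≥0} (hv : v ≠ 0) {s : ℝ} (hs : 0 ≤ s ∧ s ≤ 1) (y : ℝ) :
    (√(2 * Real.pi * v))⁻¹ * Real.exp (-(y ^ 2 + 1) / v) ≤ gaussianPDFReal 0 v (y - s) := by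
  have hv' : (0 : ℝ) < v := by positivity
  rw [gaussianPDFReal_def]
  dsimp only
  gcongr _ * Real.exp ?_
  rw [div_le_div_iff₀ hv' (by positivity)]
  nlinarith [sq_nonneg (y + s), mul_nonneg hv'.le (sq_nonneg (y + s)),
    mul_nonneg hv'.le (by nlinarith : (0 : ℝ) ≤ 1 - s ^ 2)]

/-- Uniform in `s`, from `(y - s)² ≥ y²/2 - s² ≥ y²/2 - 1`. -/
theorem gaussianPDFReal_sub_upper {v : ℝ≥0} (hv : v ≠ 0) {s : ℝ} (hs : 0 ≤ s ∧ s ≤ 1) (y : ℝ) :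
    gaussianPDFReal 0 v (y - s) ≤
      (√(2 * Real.pi * v))⁻¹ * Real.exp (-(y ^ 2 / 2 - 1) / (2 * v)) := by
  have hv' : (0 : ℝ) < v := by positivity
  rw [gaussianPDFReal_def]
  dsimp only
  gcongr
  nlinarith [sq_nonneg (y - 2 * s)]

theorem gaussianPDFReal_le (v : ℝ≥0) (y : ℝ) :
    gaussianPDFReal 0 v y ≤ (√(2 * Real.pi * v))⁻¹ := by
  rw [gaussianPDFReal_def]
  refine mul_le_of_le_one_right (by positivity) (Real.exp_le_one_iff.2 ?_)
  rw [neg_div]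
  exact neg_nonpos.2 (by positivity)

section
variable {v : ℝ≥0} {P : Measure ℝ} [IsProbabilityMeasure P]

theorem integrable_gaussianPDFReal_sub (y : ℝ) :
    Integrable (fun s => gaussianPDFReal 0 v (y - s)) P :=
  Integrable.of_bound
    ((measurable_gaussianPDFReal 0 v).comp (measurable_const.sub measurable_id)).aestronglyMeasurable
    (√(2 * Real.pi * v))⁻¹ <| ae_of_all _ fun s => by
      rw [Real.norm_eq_abs, abs_of_nonneg (gaussianPDFReal_nonneg _ _ _)]
      exact gaussianPDFReal_le _ _

theorem measurable_outputDensity : Measurable (outputDensity v P) := by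
  have : StronglyMeasurable fun p : ℝ × ℝ => gaussianPDFReal 0 v (p.1 - p.2) :=
    ((measurable_gaussianPDFReal 0 v).comp (measurable_fst.sub measurable_snd)).stronglyMeasurable
  exact this.integral_prod_right'.measurable

theorem outputDensity_lower (hv : v ≠ 0) (hP : ∀ᵐ s ∂P, 0 ≤ s ∧ s ≤ 1) (y : ℝ) :
    (√(2 * Real.pi * v))⁻¹ * Real.exp (-(y ^ 2 + 1) / v) ≤ outputDensity v P y := by
  have := integral_mono_ae (integrable_const _) (integrable_gaussianPDFReal_sub (v := v) y)
    (hP.mono fun s hs => gaussianPDFReal_sub_lower hv hs y)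
  simpa only [outputDensity, integral_const, probReal_univ, one_smul] using this

theorem outputDensity_upper (hv : v ≠ 0) (hP : ∀ᵐ s ∂P, 0 ≤ s ∧ s ≤ 1) (y : ℝ) :
    outputDensity v P y ≤ (√(2 * Real.pi * v))⁻¹ * Real.exp (-(y ^ 2 / 2 - 1) / (2 * v)) := by
  have := integral_mono_ae (integrable_gaussianPDFReal_sub (v := v) y) (integrable_const _)
    (hP.mono fun s hs => gaussianPDFReal_sub_upper hv hs y)
  simpa only [outputDensity, integral_const, probReal_univ, one_smul] using this

theorem outputDensity_le (y : ℝ) : outputDensity v P y ≤ (√(2 * Real.pi * v))⁻¹ := by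
  have := integral_mono (integrable_gaussianPDFReal_sub (v := v) (P := P) y) (integrable_const _)
    fun s => gaussianPDFReal_le v (y - s)
  simpa only [outputDensity, integral_const, probReal_univ, one_smul] using this

theorem outputDensity_pos (hv : v ≠ 0) (hP : ∀ᵐ s ∂P, 0 ≤ s ∧ s ≤ 1) (y : ℝ) :
    0 < outputDensity v P y :=
  lt_of_lt_of_le (by positivity) (outputDensity_lower hv hP y)

/-- Quadratic growth makes the log-density integrable under the channel and dominated uniformly in
the input law. -/
theorem abs_log_outputDensity_le (hv : v ≠ 0) (hP : ∀ᵐ s ∂P, 0 ≤ s ∧ s ≤ 1) (y : ℝ) :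
    |Real.log (outputDensity v P y)| ≤
      |Real.log (√(2 * Real.pi * v))⁻¹| + (y ^ 2 + 1) / v := by
  have hA : 0 < (√(2 * Real.pi * v))⁻¹ := by positivity
  have h1 := Real.log_le_log (by positivity) (outputDensity_lower hv hP y)
  have h2 := Real.log_le_log (outputDensity_pos hv hP y) (outputDensity_le y)
  rw [Real.log_mul hA.ne' (Real.exp_pos _).ne', Real.log_exp, neg_div] at h1
  have h3 : 0 ≤ (y ^ 2 + 1) / v := by positivity
  rw [abs_le]
  constructor
  · linarith [neg_abs_le (Real.log (√(2 * Real.pi * v))⁻¹)]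
  · linarith [le_abs_self (Real.log (√(2 * Real.pi * v))⁻¹)]

theorem ofReal_outputDensity (y : ℝ) :
    ENNReal.ofReal (outputDensity v P y) = ∫⁻ s, gaussianPDF 0 v (y - s) ∂P :=
  ofReal_integral_eq_lintegral_ofReal (integrable_gaussianPDFReal_sub y)
    (ae_of_all _ fun _ => gaussianPDFReal_nonneg _ _ _)

end

/-! ### Mutual information as an entropy difference -/

section
variable {E : Type*} [MeasurableSpace E] {P : Measure E} {f : E → ℝ} {v : ℝ≥0}

/-- Tonelli, then translation of the noise by `f x`. A general `f` covers the vector channel and,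
with the identity, the scalar one. -/
theorem map_channel_eq_withDensity (hf : Measurable f) (hv : v ≠ 0) :
    (P.prod (gaussianReal 0 v)).map (fun p => (p.1, f p.1 + p.2)) =
      (P.prod volume).withDensity fun p => gaussianPDF 0 v (p.2 - f p.1) := by
  have hg : Measurable fun p : E × ℝ => gaussianPDF 0 v (p.2 - f p.1) :=
    (measurable_gaussianPDF 0 v).comp (measurable_snd.sub (hf.comp measurable_fst))
  have hT : Measurable fun p : E × ℝ => (p.1, f p.1 + p.2) :=
    measurable_fst.prodMk ((hf.comp measurable_fst).add measurable_snd)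
  refine Measure.ext_of_lintegral _ fun φ hφ => ?_
  rw [lintegral_map hφ hT,
    lintegral_prod (fun p : E × ℝ => φ (p.1, f p.1 + p.2)) (hφ.comp hT).aemeasurable,
    lintegral_withDensity_eq_lintegral_mul _ hg hφ, lintegral_prod _ (hg.mul hφ).aemeasurable]
  refine lintegral_congr fun x => ?_
  rw [gaussianReal_of_var_ne_zero 0 hv, lintegral_withDensity_eq_lintegral_mul _
    (measurable_gaussianPDF 0 v) (g := fun z => φ (x, f x + z))
    ((hφ.comp hT).comp measurable_prodMk_left),
    ← lintegral_sub_right_eq_self _ (f x)]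
  simp

variable [IsProbabilityMeasure P]

theorem map_output_eq_withDensity (hf : Measurable f) (hv : v ≠ 0) :
    (P.prod (gaussianReal 0 v)).map (fun p => f p.1 + p.2) =
      volume.withDensity fun y => ENNReal.ofReal (outputDensity v (P.map f) y) := by
  have := Measure.isProbabilityMeasure_map (μ := P) hf.aemeasurable
  have hg : Measurable fun p : E × ℝ => gaussianPDF 0 v (p.2 - f p.1) :=
    (measurable_gaussianPDF 0 v).comp (measurable_snd.sub (hf.comp measurable_fst))
  have hT : Measurable fun p : E × ℝ => (p.1, f p.1 + p.2) :=
    measurable_fst.prodMk ((hf.comp measurable_fst).add measurable_snd)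
  have e : (P.prod (gaussianReal 0 v)).map (fun p => f p.1 + p.2) =
      ((P.prod (gaussianReal 0 v)).map (fun p => (p.1, f p.1 + p.2))).map Prod.snd :=
    (Measure.map_map measurable_snd hT).symm
  rw [e, map_channel_eq_withDensity hf hv]
  refine Measure.ext_of_lintegral _ fun φ hφ => ?_
  rw [lintegral_map hφ measurable_snd, lintegral_withDensity_eq_lintegral_mul _ hg
    (g := fun p : E × ℝ => φ p.2) (hφ.comp measurable_snd), lintegral_prod_symm ((fun p : E × ℝ => gaussianPDF 0 v (p.2 - f p.1)) *
      fun p : E × ℝ => φ p.2) (hg.mul (hφ.comp measurable_snd)).aemeasurable,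
    lintegral_withDensity_eq_lintegral_mul _ measurable_outputDensity.ennreal_ofReal hφ]
  refine lintegral_congr fun y => ?_
  have hy : Measurable fun s => gaussianPDF 0 v (y - s) :=
    (measurable_gaussianPDF 0 v).comp (measurable_const.sub measurable_id)
  simp only [Pi.mul_apply, ofReal_outputDensity]
  rw [lintegral_mul_const (f := fun x => gaussianPDF 0 v (y - f x)) _ (hy.comp hf),
    lintegral_map hy hf]

/-- Identifies the density of the joint law against the product of its marginals; positivity of the
output density permits the quotient. -/
theorem map_channel_eq_prod_withDensity (hf : Measurable f) (hv : v ≠ 0)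
    (hP : ∀ᵐ x ∂P, 0 ≤ f x ∧ f x ≤ 1) :
    (P.prod (gaussianReal 0 v)).map (fun p => (p.1, f p.1 + p.2)) =
      (P.prod ((P.prod (gaussianReal 0 v)).map (fun p => f p.1 + p.2))).withDensity fun p =>
        ENNReal.ofReal (gaussianPDFReal 0 v (p.2 - f p.1) / outputDensity v (P.map f) p.2) := by
  have := Measure.isProbabilityMeasure_map (μ := P) hf.aemeasurable
  have hP' : ∀ᵐ s ∂P.map f, 0 ≤ s ∧ s ≤ 1 :=
    (ae_map_iff hf.aemeasurable (measurableSet_Icc (a := (0 : ℝ)) (b := 1))).2 hP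
  have hq : Measurable (outputDensity v (P.map f)) := measurable_outputDensity
  rw [map_channel_eq_withDensity hf hv, map_output_eq_withDensity hf hv,
    prod_withDensity_right hq.ennreal_ofReal, ← withDensity_mul]
  · congr 1
    funext p
    have hpos := outputDensity_pos hv hP' p.2
    rw [Pi.mul_apply, ← ENNReal.ofReal_mul hpos.le, mul_div_cancel₀ _ hpos.ne', gaussianPDF]
  · exact (hq.comp measurable_snd).ennreal_ofReal
  · exact (((measurable_gaussianPDFReal 0 v).comp (measurable_snd.sub
      (hf.comp measurable_fst))).div (hq.comp measurable_snd)).ennreal_ofReal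

theorem integrable_sq_gaussianReal : Integrable (fun z => z ^ 2) (gaussianReal 0 v) :=
  (memLp_id_gaussianReal' 2 (by simp)).integrable_sq

theorem log_gaussianPDFReal (hv : v ≠ 0) (z : ℝ) :
    Real.log (gaussianPDFReal 0 v z) =
      Real.log (√(2 * Real.pi * v))⁻¹ - z ^ 2 / (2 * v) := by
  have : (0 : ℝ) < v := by positivity
  rw [gaussianPDFReal_def]
  dsimp only
  rw [Real.log_mul (by positivity) (Real.exp_pos _).ne', Real.log_exp, sub_zero]
  ring

/-- The mutual information of the additive Gaussian channel is the differential entropy of the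
output minus that of the noise. -/
theorem mutualInfo_channel (hf : Measurable f) (hv : v ≠ 0)
    (hP : ∀ᵐ x ∂P, 0 ≤ f x ∧ f x ≤ 1) :
    mutualInfo (P.prod (gaussianReal 0 v)) (fun p => p.1) (fun p => f p.1 + p.2) =
      ENNReal.ofReal (∫ z, Real.log (gaussianPDFReal 0 v z) ∂gaussianReal 0 v -
        ∫ y, outputDensity v (P.map f) y * Real.log (outputDensity v (P.map f) y)) := by
  have := Measure.isProbabilityMeasure_map (μ := P) hf.aemeasurable
  have hP' : ∀ᵐ s ∂P.map f, 0 ≤ s ∧ s ≤ 1 :=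
    (ae_map_iff hf.aemeasurable (measurableSet_Icc (a := (0 : ℝ)) (b := 1))).2 hP
  have hq : Measurable (outputDensity v (P.map f)) := measurable_outputDensity
  have hT : Measurable fun p : E × ℝ => (p.1, f p.1 + p.2) :=
    measurable_fst.prodMk ((hf.comp measurable_fst).add measurable_snd)
  have hT2 : Measurable fun p : E × ℝ => f p.1 + p.2 := measurable_snd.comp hT
  have hφ : Measurable (gaussianPDFReal 0 v) := measurable_gaussianPDFReal 0 v
  have hfst : (P.prod (gaussianReal 0 v)).map (fun p => p.1) = P := by
    simp
  have hJ := map_channel_eq_prod_withDensity hf hv hP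
  set J := (P.prod (gaussianReal 0 v)).map (fun p => (p.1, f p.1 + p.2)) with hJdef
  set Q := (P.prod (gaussianReal 0 v)).map (fun p => f p.1 + p.2) with hQdef
  have : IsProbabilityMeasure Q := Measure.isProbabilityMeasure_map hT2.aemeasurable
  have : IsProbabilityMeasure J := Measure.isProbabilityMeasure_map hT.aemeasurable
  have hac : J ≪ P.prod Q := hJ ▸ withDensity_absolutelyContinuous _ _
  have hr : Measurable fun p : E × ℝ =>
      ENNReal.ofReal (gaussianPDFReal 0 v (p.2 - f p.1) / outputDensity v (P.map f) p.2) :=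
    ((hφ.comp (measurable_snd.sub (hf.comp measurable_fst))).div
      (hq.comp measurable_snd)).ennreal_ofReal
  have hllr : llr J (P.prod Q) =ᵐ[J] fun p => Real.log (gaussianPDFReal 0 v (p.2 - f p.1)) -
      Real.log (outputDensity v (P.map f) p.2) := by
    have h1 : J.rnDeriv (P.prod Q) =ᵐ[P.prod Q] fun p : E × ℝ =>
        ENNReal.ofReal (gaussianPDFReal 0 v (p.2 - f p.1) / outputDensity v (P.map f) p.2) := by
      conv_lhs => rw [hJ]
      exact Measure.rnDeriv_withDensity _ hr
    filter_upwards [hac.ae_le h1] with p hp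
    have h2 := gaussianPDFReal_pos 0 v (p.2 - f p.1) hv
    have h3 := outputDensity_pos hv hP' p.2
    rw [llr_def]
    dsimp only
    rw [hp, ENNReal.toReal_ofReal (div_pos h2 h3).le, Real.log_div h2.ne' h3.ne']
  have hm1 : Measurable fun p : E × ℝ => Real.log (gaussianPDFReal 0 v (p.2 - f p.1)) :=
    (hφ.comp (measurable_snd.sub (hf.comp measurable_fst))).log
  have hm2 : Measurable fun p : E × ℝ => Real.log (outputDensity v (P.map f) p.2) :=
    (hq.comp measurable_snd).log
  have hlogN : Integrable (fun z => Real.log (gaussianPDFReal 0 v z)) (gaussianReal 0 v) := by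
    simp only [log_gaussianPDFReal hv]
    exact (integrable_const _).sub (integrable_sq_gaussianReal.div_const _)
  have hi1 : Integrable (fun p : E × ℝ => Real.log (gaussianPDFReal 0 v (p.2 - f p.1))) J := by
    rw [hJdef, integrable_map_measure hm1.aestronglyMeasurable hT.aemeasurable]
    simpa [Function.comp_def] using hlogN.comp_snd P
  have hi2 : Integrable (fun p : E × ℝ => Real.log (outputDensity v (P.map f) p.2)) J := by
    rw [hJdef, integrable_map_measure hm2.aestronglyMeasurable hT.aemeasurable]
    -- The bound comes from `(f x + z)² + 1 ≤ 2z² + 3`, valid for `0 ≤ f x ≤ 1`.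
    have hb : Integrable (fun p : E × ℝ => |Real.log (√(2 * Real.pi * v))⁻¹| +
        ((2 * p.2 ^ 2 + 3) / v)) (P.prod (gaussianReal 0 v)) :=
      (integrable_const _).add ((((integrable_sq_gaussianReal.comp_snd P).const_mul 2).add
        (integrable_const _)).div_const _)
    refine hb.mono' (hm2.comp hT).aestronglyMeasurable ?_
    have hP2 : ∀ᵐ p ∂P.prod (gaussianReal 0 v), 0 ≤ f p.1 ∧ f p.1 ≤ 1 :=
      Measure.quasiMeasurePreserving_fst.ae hP
    filter_upwards [hP2] with p hp
    refine (abs_log_outputDensity_le hv hP' _).trans ?_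
    have hv' : (0 : ℝ) < v := by positivity
    dsimp only
    gcongr _ + ?_ / _
    nlinarith [sq_nonneg (p.2 - f p.1)]
  have hint : Integrable (llr J (P.prod Q)) J := (integrable_congr hllr).2 (hi1.sub hi2)
  have hval : ∫ p, llr J (P.prod Q) p ∂J =
      ∫ z, Real.log (gaussianPDFReal 0 v z) ∂gaussianReal 0 v -
        ∫ y, outputDensity v (P.map f) y * Real.log (outputDensity v (P.map f) y) := by
    rw [integral_congr_ae hllr, integral_sub hi1 hi2]
    congr 1
    · rw [hJdef, integral_map hT.aemeasurable hm1.aestronglyMeasurable]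
      simp only [add_sub_cancel_left]
      rw [integral_fun_snd (fun z => Real.log (gaussianPDFReal 0 v z))]
      simp
    · have h1 : J.map Prod.snd = Q := Measure.map_map measurable_snd hT
      have h2 : ∫ p, Real.log (outputDensity v (P.map f) p.2) ∂J =
          ∫ y, Real.log (outputDensity v (P.map f) y) ∂Q := by
        rw [← h1, integral_map measurable_snd.aemeasurable hq.log.aestronglyMeasurable]
      rw [h2, hQdef, map_output_eq_withDensity hf hv,
        integral_withDensity_eq_integral_toReal_smul hq.ennreal_ofReal
          (ae_of_all _ fun _ => ENNReal.ofReal_lt_top)]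
      refine integral_congr_ae (ae_of_all _ fun y => ?_)
      simp only [smul_eq_mul]
      rw [ENNReal.toReal_ofReal (outputDensity_pos hv hP' y).le]
  unfold mutualInfo
  -- The mass terms in `klDiv` cancel, both measures being probabilities.
  rw [hfst, ← hJdef, ← hQdef, InformationTheory.klDiv_of_ac_of_integrable hac hint, hval]
  simp

end

theorem sisoInfo_eq {σ : ℝ≥0} (hσ : 0 < σ) {P : Measure ℝ} [IsProbabilityMeasure P]
    (hP : ∀ᵐ s ∂P, 0 ≤ s ∧ s ≤ 1) :
    sisoInfo σ P = ENNReal.ofReal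
      (∫ z, Real.log (gaussianPDFReal 0 (σ ^ 2) z) ∂gaussianReal 0 (σ ^ 2) -
        ∫ y, outputDensity (σ ^ 2) P y * Real.log (outputDensity (σ ^ 2) P y)) := by
  have := mutualInfo_channel (f := fun s => s) measurable_id (pow_pos hσ 2).ne' hP
  rwa [Measure.map_id'] at this

/-- Both sides are the same entropy difference, since `mutualInfo_channel` involves `P` only through
`P.map f`. -/
theorem misoInfo_eq_sisoInfo_map {n : ℕ} (h : Fin n → ℝ) {σ : ℝ≥0} (hσ : 0 < σ)
    {P : Measure (Fin n → ℝ)} [IsProbabilityMeasure P]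
    (hP : ∀ᵐ s ∂P.map (fun x => ∑ i, h i * x i), 0 ≤ s ∧ s ≤ 1) :
    misoInfo h σ P = sisoInfo σ (P.map fun x => ∑ i, h i * x i) := by
  have hm : Measurable fun x : Fin n → ℝ => ∑ i, h i * x i := by fun_prop
  have := Measure.isProbabilityMeasure_map (μ := P) hm.aemeasurable
  rw [sisoInfo_eq hσ hP]
  exact mutualInfo_channel hm (pow_pos hσ 2).ne'
    ((ae_map_iff hm.aemeasurable (measurableSet_Icc (a := (0 : ℝ)) (b := 1))).1 hP)

/-! ### Weak compactness and continuity -/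

/-- The law on `ℝ` of a law on the unit interval. -/
noncomputable def unitLaw (P : ProbabilityMeasure (Set.Icc (0 : ℝ) 1)) : Measure ℝ :=
  (P : Measure (Set.Icc (0 : ℝ) 1)).map Subtype.val

instance (P : ProbabilityMeasure (Set.Icc (0 : ℝ) 1)) : IsProbabilityMeasure (unitLaw P) :=
  Measure.isProbabilityMeasure_map measurable_subtype_coe.aemeasurable

theorem ae_unitLaw (P : ProbabilityMeasure (Set.Icc (0 : ℝ) 1)) :
    ∀ᵐ s ∂unitLaw P, 0 ≤ s ∧ s ≤ 1 :=
  (ae_map_iff measurable_subtype_coe.aemeasurable (measurableSet_Icc (a := (0 : ℝ)) (b := 1))).2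
    (ae_of_all _ fun s => s.2)

theorem exists_unitLaw_eq {P : Measure ℝ} [IsProbabilityMeasure P]
    (hP : ∀ᵐ s ∂P, 0 ≤ s ∧ s ≤ 1) : ∃ R, unitLaw R = P := by
  have hmap : (P.comap Subtype.val).map (Subtype.val : Set.Icc (0 : ℝ) 1 → ℝ) = P := by
    rw [map_comap_subtype_coe measurableSet_Icc]
    exact Measure.restrict_eq_self_of_ae_mem hP
  have : IsProbabilityMeasure (P.comap (Subtype.val : Set.Icc (0 : ℝ) 1 → ℝ)) :=
    ⟨by rw [← Set.preimage_univ (f := (Subtype.val : Set.Icc (0 : ℝ) 1 → ℝ)),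
      ← Measure.map_apply measurable_subtype_coe MeasurableSet.univ, hmap, measure_univ]⟩
  exact ⟨⟨_, this⟩, hmap⟩

/-- On the compact interval `g` is bounded, hence a test function for weak convergence. -/
theorem continuous_integral_unitLaw {g : ℝ → ℝ} (hg : Continuous g) :
    Continuous fun P => ∫ s, g s ∂unitLaw P := by
  have e : ∀ P, ∫ s, g s ∂unitLaw P =
      ∫ s : Set.Icc (0 : ℝ) 1, g s ∂(P : Measure (Set.Icc (0 : ℝ) 1)) := fun P =>
    integral_map measurable_subtype_coe.aemeasurable hg.aestronglyMeasurable
  simp only [e]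
  exact ProbabilityMeasure.continuous_integral_boundedContinuousFunction
    (BoundedContinuousFunction.mkOfCompact ⟨fun s : Set.Icc (0 : ℝ) 1 => g s, by fun_prop⟩)

theorem continuous_outputDensity_unitLaw (v : ℝ≥0) (y : ℝ) :
    Continuous fun P => outputDensity v (unitLaw P) y := by
  refine continuous_integral_unitLaw ?_
  simp only [gaussianPDFReal_def]
  fun_prop

/-- The dominating function for the entropy integrand: upper envelope times the bound on the
logarithm. -/
theorem integrable_entropy_bound {v : ℝ≥0} (hv : v ≠ 0) (C : ℝ) :
    Integrable fun y : ℝ => (√(2 * Real.pi * v))⁻¹ * Real.exp (-(y ^ 2 / 2 - 1) / (2 * v)) *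
      (C + (y ^ 2 + 1) / v) := by
  -- The envelope's exponent is `1/(2v) - y²/(4v)`.
  have hb : (0 : ℝ) < (4 * v : ℝ)⁻¹ := by positivity
  have h1 := integrable_exp_neg_mul_sq hb
  have h2 : Integrable fun y : ℝ => y ^ 2 * Real.exp (-(4 * v : ℝ)⁻¹ * y ^ 2) := by
    have := integrable_rpow_mul_exp_neg_mul_sq hb (s := 2) (by norm_num)
    simpa using this
  convert! ((h1.const_mul (C + 1 / v)).add (h2.const_mul (1 / v : ℝ))).const_mul
    ((√(2 * Real.pi * v))⁻¹ * Real.exp (1 / (2 * v))) using 2 with y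
  have : Real.exp (-(y ^ 2 / 2 - 1) / (2 * v)) =
      Real.exp (1 / (2 * v)) * Real.exp (-(4 * v : ℝ)⁻¹ * y ^ 2) := by
    rw [← Real.exp_add]
    congr 1
    field_simp
    ring
  rw [this, Pi.add_apply]
  ring

/-- The differential entropy of the output is a continuous function of the input law. -/
theorem continuous_entropy_unitLaw {v : ℝ≥0} (hv : v ≠ 0) :
    Continuous fun P => ∫ y, outputDensity v (unitLaw P) y *
      Real.log (outputDensity v (unitLaw P) y) := by
  refine continuous_of_dominated (fun P => ?_) (fun P => ae_of_all _ fun y => ?_)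
    (integrable_entropy_bound hv |Real.log (√(2 * Real.pi * v))⁻¹|) (ae_of_all _ fun y => ?_)
  · exact (measurable_outputDensity.mul measurable_outputDensity.log).aestronglyMeasurable
  · rw [norm_mul, Real.norm_eq_abs, Real.norm_eq_abs,
      abs_of_pos (outputDensity_pos hv (ae_unitLaw P) y)]
    exact mul_le_mul (outputDensity_upper hv (ae_unitLaw P) y)
      (abs_log_outputDensity_le hv (ae_unitLaw P) y) (abs_nonneg _) (by positivity)
  · exact Real.continuous_mul_log.comp (continuous_outputDensity_unitLaw v y)

theorem continuous_sisoInfo_unitLaw {σ : ℝ≥0} (hσ : 0 < σ) :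
    Continuous fun P => sisoInfo σ (unitLaw P) := by
  simp only [sisoInfo_eq hσ (ae_unitLaw _)]
  exact ENNReal.continuous_ofReal.comp
    (continuous_const.sub (continuous_entropy_unitLaw (pow_pos hσ 2).ne'))

theorem isClosed_isStopLossLaw {n : ℕ} (h α : Fin n → ℝ) :
    IsClosed {P | IsStopLossLaw h α (unitLaw P)} := by
  have e : {P | IsStopLossLaw h α (unitLaw P)} = ⋂ k : ℕ, ⋂ _ : k < n,
      {P | ∫ s, max (s - cumGain h k) 0 ∂unitLaw P ≤ (1 - cumGain h k) * tailMean h α k} := by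
    ext P
    simp only [Set.mem_iInter, Set.mem_ofPred_eq]
    exact ⟨fun hP => hP.2.2, fun hP => ⟨inferInstance, ae_unitLaw P, hP⟩⟩
  rw [e]
  exact isClosed_iInter fun k => isClosed_iInter fun _ =>
    isClosed_le (continuous_integral_unitLaw (by fun_prop)) continuous_const

/-- Shows that the feasible set is nonempty, as the extreme value theorem requires. -/
theorem isStopLossLaw_dirac_zero {n : ℕ} {h α : Fin n → ℝ} (hh : ∀ k, 0 < h k)
    (hsum : ∑ k, h k = 1) (hα0 : ∀ k, 0 ≤ α k) : IsStopLossLaw h α (Measure.dirac 0) := by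
  refine ⟨inferInstance, ?_, fun k hk => ?_⟩
  · rw [ae_dirac_eq]
    exact ⟨le_rfl, zero_le_one⟩
  · rw [integral_dirac, one_sub_cumGain_mul_tailMean hh hsum α hk, max_eq_right]
    · exact Finset.sum_nonneg fun i _ => mul_nonneg (hh i).le (hα0 i)
    · rw [zero_sub, neg_nonpos]
      exact Finset.sum_nonneg fun i _ => (hh i).le

theorem exists_isStopLossLaw_maximal {n : ℕ} {h α : Fin n → ℝ} {σ : ℝ≥0} (hh : ∀ k, 0 < h k)
    (hsum : ∑ k, h k = 1) (hα0 : ∀ k, 0 ≤ α k) (hσ : 0 < σ) :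
    ∃ P, IsStopLossLaw h α P ∧ ∀ Q, IsStopLossLaw h α Q → sisoInfo σ Q ≤ sisoInfo σ P := by
  obtain ⟨R, hR, hmax⟩ := (isClosed_isStopLossLaw h α).isCompact.exists_isMaxOn
    (by
      obtain ⟨R, hR⟩ := exists_unitLaw_eq (isStopLossLaw_dirac_zero hh hsum hα0).2.1
      exact ⟨R, show IsStopLossLaw h α (unitLaw R) from
        hR ▸ isStopLossLaw_dirac_zero hh hsum hα0⟩)
    (continuous_sisoInfo_unitLaw hσ).continuousOn
  refine ⟨unitLaw R, hR, fun Q hQ => ?_⟩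
  have := hQ.1
  obtain ⟨S, rfl⟩ := exists_unitLaw_eq hQ.2.1
  exact hmax hQ

/-! ### Capacity as a scalar maximum -/

/-- The two sets of attainable values coincide, not only their suprema. -/
theorem capacityB_eq_sSup {n : ℕ} {h α : Fin n → ℝ} {σ : ℝ≥0} (hh : ∀ k, 0 < h k)
    (hsum : ∑ k, h k = 1) (hα : Antitone α) (hσ : 0 < σ) :
    capacityB h α σ = sSup {I | ∃ P : Measure ℝ, IsStopLossLaw h α P ∧ I = sisoInfo σ P} := by
  unfold capacityB
  congr 1
  ext I
  constructor
  · rintro ⟨P, hP, rfl⟩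
    have := hP.1
    have hQ := hP.isStopLossLaw_map hh hsum
    exact ⟨_, hQ, misoInfo_eq_sisoInfo_map h hσ hQ.2.1⟩
  · rintro ⟨Q, hQ, rfl⟩
    obtain ⟨P, hP, rfl⟩ := hQ.exists_isBoundedCostLaw hh hsum hα
    have := hP.1
    exact ⟨P, hP, (misoInfo_eq_sisoInfo_map h hσ hQ.2.1).symm⟩

theorem corollary3 (n : ℕ) (h α : Fin n → ℝ) (σ : ℝ≥0)
    (hh : ∀ k, 0 < h k) (hsum : ∑ k, h k = 1)
    (hα0 : ∀ k, 0 ≤ α k) (hα1 : ∀ k, α k ≤ 1) (hα : Antitone α) (hσ : 0 < σ) :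
    IsGreatest {I : ℝ≥0∞ | ∃ P : Measure ℝ, IsStopLossLaw h α P ∧ I = sisoInfo σ P}
      (capacityB h α σ) := by
  obtain ⟨P, hP, hmax⟩ := exists_isStopLossLaw_maximal (σ := σ) hh hsum hα0 hσ
  have hg : IsGreatest {I : ℝ≥0∞ | ∃ P : Measure ℝ, IsStopLossLaw h α P ∧ I = sisoInfo σ P}
      (sisoInfo σ P) := ⟨⟨P, hP, rfl⟩, by rintro _ ⟨Q, hQ, rfl⟩; exact hmax Q hQ⟩
  rwa [capacityB_eq_sSup hh hsum hα hσ, hg.csSup_eq]
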